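/- For $x$ in the closed unit disk $\overline{\mathbb D}=\{x\in\mathbb C : |x|\le 1\}$ let $\mathrm{Li}_2(x)=\sum_{n=1}^\infty \frac{x^n}{n^2}$ be the dilogarithm and, for every integer $k\ge 1$, put $$f_k(x)=\frac1k\,\Re\sqrt{\mathrm{Li}_2(x^k)},$$ where $\sqrt{\cdot}$ is the principal branch of the square root (so $\Re\sqrt{\cdot}\ge 0$). Define $$\mathcal R(1)=\{x\in\overline{\mathbb D}: f_1(x)\ge f_2(x),\ f_1(x)\ge f_3(x)\},$$ $$\mathcal R(2)=\{x\in\overline{\mathbb D}: f_2(x)\ge f_1(x),\ f_2(x)\ge f_3(x)\},$$ $$\mathcal R(3)=\{x\in\overline{\mathbb D}: f_3(x)\ge f_1(x),\ f_3(x)\ge f_2(x)\}.$$ Then: (a) $f_k(x)\le \max[f_1(x),f_2(x),f_3(x)]$ for all $x\in\overline{\mathbb D}$ and all $k\ge 4$. (b) For $x\in\mathcal R(1)$, $f_1(x)\ge f_k(x)$ for all $k\ge 2$. (c) For $x\in\mathcal R(2)$, $f_2(x)\ge f_k(x)$ for all $k\ge 3$ and for $k=1$. (d) For $x\in\mathcal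 R(3)$, $f_3(x)\ge f_k(x)$ for all $k\ge 4$ and for $k=1,2$. -/

import Mathlib

/-- The dilogarithm `Li₂(x) = ∑_{n ≥ 1} xⁿ / n²`; the series converges absolutely for `‖x‖ ≤ 1`. -/
noncomputable def dilog (x : ℂ) : ℂ :=
  ∑' n : ℕ, x ^ (n + 1) / ((n : ℂ) + 1) ^ 2

/-- `f_k(x) = (1/k) Re √(Li₂(x^k))`, with the principal square root. -/
noncomputable def dilogF (k : ℕ) (x : ℂ) : ℝ :=
  (1 / (k : ℝ)) * (Complex.sqrt (dilog (x ^ k))).re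

/-- The closed unit disk. -/
def unitDisk : Set ℂ := Metric.closedBall 0 1

/-- The region of the unit disk where `f_1 ≥ f_2` and `f_1 ≥ f_3`. -/
def regionOne : Set ℂ :=
  {x | x ∈ unitDisk ∧ dilogF 2 x ≤ dilogF 1 x ∧ dilogF 3 x ≤ dilogF 1 x}

/-- The region of the unit disk where `f_2 ≥ f_1` and `f_2 ≥ f_3`. -/
def regionTwo : Set ℂ :=
  {x | x ∈ unitDisk ∧ dilogF 1 x ≤ dilogF 2 x ∧ dilogF 3 x ≤ dilogF 2 x}

/-- The region of the unit disk where `f_3 ≥ f_1` and `f_3 ≥ f_2`. -/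
def regionThree : Set ℂ :=
  {x | x ∈ unitDisk ∧ dilogF 1 x ≤ dilogF 3 x ∧ dilogF 2 x ≤ dilogF 3 x}

open MeasureTheory Set

/-! For `k ≥ 4` even `max (f_1, f_2)` dominates `f_k`; the region statements follow at once. Since
`f_k² = (|Li₂(x^k)| + Re Li₂(x^k)) / (2k²)`, square roots disappear. Above, `|Li₂(z)| ≤ (π²/6)|z|`
makes `f_k²` of order `|x|²/k²`. Below, `dilog_lower_bound` bounds `f_1²` by a multiple of `|x| + Re
x` and `f_2²` by a multiple of `(Re x)²`: the first is small only near the negative axis, where the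
second is large. For `k = 4` the upper bound is too weak, so the sign of `Re x⁴` is used as well. -/

/-! ### Integral representation of the dilogarithm -/

theorem integrableOn_pow_mul_neg_log (n : ℕ) :
    IntegrableOn (fun t : ℝ => t ^ n * -Real.log t) (Ioo 0 1) := by
  have h : IntervalIntegrable (fun t : ℝ => t ^ n * -Real.log t) volume 0 1 :=
    (intervalIntegral.intervalIntegrable_log').neg.continuousOn_mul (by fun_prop)
  exact ((intervalIntegrable_iff_integrableOn_Ioc_of_le zero_le_one).1 h).mono_set Ioo_subset_Ioc_self

theorem integral_pow_mul_neg_log (n : ℕ) :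
    ∫ t in Ioo (0 : ℝ) 1, t ^ n * -Real.log t = 1 / ((n : ℝ) + 1) ^ 2 := by
  have hn : (n : ℝ) + 1 ≠ 0 := by positivity
  have hint : IntervalIntegrable (fun t : ℝ => t ^ n * -Real.log t) volume 0 1 :=
    (intervalIntegral.intervalIntegrable_log').neg.continuousOn_mul (by fun_prop)
  rw [← integral_Ioc_eq_integral_Ioo, ← intervalIntegral.integral_of_le zero_le_one,
    intervalIntegral.integral_eq_sub_of_hasDerivAt_of_le
      -- Grouping `t * log t` keeps the antiderivative visibly continuous at 0.
      (f := fun t : ℝ => t ^ (n + 1) / ((n : ℝ) + 1) ^ 2 - t ^ n * (t * Real.log t) / ((n : ℝ) + 1))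
      zero_le_one _ _ hint]
  · simp
  · have := Real.continuous_mul_log
    exact Continuous.continuousOn (by fun_prop)
  · intro t ht
    have ht0 : t ≠ 0 := ht.1.ne'
    have h1 := (hasDerivAt_pow (n + 1) t).div_const (((n : ℝ) + 1) ^ 2)
    have h2 := ((hasDerivAt_pow (n + 1) t).mul (Real.hasDerivAt_log ht0)).div_const ((n : ℝ) + 1)
    refine ((h1.sub h2).congr_of_eventuallyEq (.of_forall fun s => ?_)).congr_deriv ?_
    · simp only [Pi.sub_apply, Pi.mul_apply]
      ring
    · push_cast
      field_simp
      ring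

/-- This is `log s ≤ s - 1` at `s = t^(-1/2)`. The factor `1 - t` cancels the pole of the kernel at
`t = 1` when `|x| = 1`. -/
theorem neg_log_le_div_sqrt {t : ℝ} (ht : t ∈ Ioo (0 : ℝ) 1) :
    -Real.log t ≤ 2 * ((1 - t) * t ^ (-(1 / 2) : ℝ)) := by
  obtain ⟨h0, h1⟩ := ht
  have hs : 0 < √t := Real.sqrt_pos.2 h0
  have hsq : √t ^ 2 = t := Real.sq_sqrt h0.le
  have hs1 : √t ≤ 1 := Real.sqrt_le_one.2 h1.le
  have hlog := Real.log_le_sub_one_of_pos (inv_pos.2 hs)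
  rw [Real.log_inv, Real.log_sqrt h0.le] at hlog
  rw [Real.rpow_neg h0.le, ← Real.sqrt_eq_rpow]
  have : (√t)⁻¹ - 1 ≤ (1 - t) * (√t)⁻¹ := by
    rw [sub_mul, one_mul]
    have : t * (√t)⁻¹ = √t := by field_simp; exact hsq.symm
    linarith
  linarith

theorem one_sub_le_norm_one_sub_mul {x : ℂ} (hx : ‖x‖ ≤ 1) {t : ℝ} (ht : 0 ≤ t) :
    1 - t ≤ ‖1 - x * t‖ := by
  have h := norm_sub_norm_le (1 : ℂ) (x * t)
  rw [norm_one, norm_mul, Complex.norm_real, Real.norm_of_nonneg ht] at h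
  nlinarith

theorem integrableOn_dilog_kernel {x : ℂ} (hx : ‖x‖ ≤ 1) :
    IntegrableOn (fun t : ℝ => x / (1 - x * t) * ((-Real.log t : ℝ) : ℂ)) (Ioo 0 1) := by
  have hdom : IntegrableOn (fun t : ℝ => 2 * t ^ (-(1 / 2) : ℝ)) (Ioo 0 1) := by
    have h := (intervalIntegral.intervalIntegrable_rpow' (a := 0) (b := 1)
      (r := (-(1 / 2) : ℝ)) (by norm_num)).const_mul 2
    exact ((intervalIntegrable_iff_integrableOn_Ioc_of_le zero_le_one).1 h).mono_set
      Ioo_subset_Ioc_self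
  refine Integrable.mono' hdom (Measurable.aestronglyMeasurable (by fun_prop)) ?_
  filter_upwards [ae_restrict_mem measurableSet_Ioo] with t ht
  have h1 : 0 < 1 - t := sub_pos.2 ht.2
  have h2 := one_sub_le_norm_one_sub_mul hx ht.1.le
  have hl : 0 ≤ -Real.log t := neg_nonneg.2 (Real.log_nonpos ht.1.le ht.2.le)
  rw [norm_mul, norm_div, Complex.norm_real, Real.norm_of_nonneg hl]
  calc ‖x‖ / ‖1 - x * t‖ * -Real.log t
      ≤ 1 / (1 - t) * (2 * ((1 - t) * t ^ (-(1 / 2) : ℝ))) :=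
        mul_le_mul (div_le_div₀ zero_le_one hx h1 h2) (neg_log_le_div_sqrt ht) hl (by positivity)
    _ = 2 * t ^ (-(1 / 2) : ℝ) := by field_simp

theorem summable_one_div_succ_sq : Summable fun n : ℕ => 1 / ((n : ℝ) + 1) ^ 2 := by
  have := (summable_nat_add_iff 1).2 hasSum_zeta_two.summable
  simpa using this

/-- The dilogarithm is an average of the Möbius kernels `x / (1 - x t)` for the weight `-log t`. -/
theorem dilog_eq_integral {x : ℂ} (hx : ‖x‖ ≤ 1) :
    dilog x = ∫ t in Ioo (0 : ℝ) 1, x / (1 - x * t) * ((-Real.log t : ℝ) : ℂ) := by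
  let F : ℕ → ℝ → ℂ := fun n t => x ^ (n + 1) * ((t ^ n * -Real.log t : ℝ) : ℂ)
  have hF (n : ℕ) : IntegrableOn (F n) (Ioo 0 1) :=
    (integrableOn_pow_mul_neg_log n).ofReal.const_mul _
  have hnorm (n : ℕ) : ∫ t in Ioo (0 : ℝ) 1, ‖F n t‖ = ‖x‖ ^ (n + 1) * (1 / ((n : ℝ) + 1) ^ 2) := by
    rw [← integral_pow_mul_neg_log, ← integral_const_mul]
    refine setIntegral_congr_fun measurableSet_Ioo fun t ht => ?_
    have hl : 0 ≤ -Real.log t := neg_nonneg.2 (Real.log_nonpos ht.1.le ht.2.le)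
    have ht0 := ht.1.le
    simp only [F]
    rw [norm_mul, norm_pow, Complex.norm_real, Real.norm_of_nonneg (by positivity)]
  have hsum : Summable fun n => ∫ t in Ioo (0 : ℝ) 1, ‖F n t‖ := by
    simp_rw [hnorm]
    refine summable_one_div_succ_sq.of_nonneg_of_le (fun n => by positivity) fun n => ?_
    exact mul_le_of_le_one_left (by positivity) (pow_le_one₀ (norm_nonneg x) hx)
  have key := (hasSum_integral_of_summable_integral_norm hF hsum).tsum_eq
  have hint (n : ℕ) : ∫ t in Ioo (0 : ℝ) 1, F n t = x ^ (n + 1) / ((n : ℂ) + 1) ^ 2 := by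
    simp only [F]
    rw [integral_const_mul, integral_complex_ofReal, integral_pow_mul_neg_log]
    push_cast
    ring
  simp_rw [hint] at key
  rw [dilog, key]
  refine setIntegral_congr_fun measurableSet_Ioo fun t ht => ?_
  have hxt : ‖x * t‖ < 1 := by
    rw [norm_mul, Complex.norm_real, Real.norm_of_nonneg ht.1.le]
    exact (mul_le_of_le_one_left ht.1.le hx).trans_lt ht.2
  have hF' (n : ℕ) : F n t = (x * t) ^ n * (x * ((-Real.log t : ℝ) : ℂ)) := by
    simp only [F]
    push_cast
    ring
  simp_rw [hF']
  rw [tsum_mul_right, tsum_geometric_of_norm_lt_one hxt]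
  ring

theorem re_mul_dilog_eq_integral {x : ℂ} (hx : ‖x‖ ≤ 1) (c : ℂ) :
    (c * dilog x).re =
      ∫ t in Ioo (0 : ℝ) 1, (c * (x / (1 - x * t))).re * -Real.log t := by
  rw [dilog_eq_integral hx, ← integral_const_mul, ← Complex.reCLM_apply,
    ← ContinuousLinearMap.integral_comp_comm _ ((integrableOn_dilog_kernel hx).const_mul c)]
  refine integral_congr_ae (.of_forall fun t => ?_)
  simp only [Complex.reCLM_apply]
  rw [← mul_assoc, Complex.re_mul_ofReal]

theorem integrableOn_re_dilog_kernel {x : ℂ} (hx : ‖x‖ ≤ 1) (c : ℂ) :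
    IntegrableOn (fun t : ℝ => (c * (x / (1 - x * t))).re * -Real.log t) (Ioo 0 1) := by
  have h := ((integrableOn_dilog_kernel hx).const_mul c).re
  refine Integrable.congr h (.of_forall fun t => ?_)
  simp only [RCLike.re_to_complex]
  rw [← mul_assoc, Complex.re_mul_ofReal]

/-! ### Bounds for the dilogarithm on the disk -/

theorem norm_dilog_le {z : ℂ} (hz : ‖z‖ ≤ 1) : ‖dilog z‖ ≤ Real.pi ^ 2 / 6 * ‖z‖ := by
  have hs : HasSum (fun n : ℕ => 1 / ((n : ℝ) + 1) ^ 2) (Real.pi ^ 2 / 6) := by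
    have := (hasSum_nat_add_iff' 1).2 hasSum_zeta_two
    simpa using this
  refine tsum_of_norm_bounded (hs.mul_right ‖z‖) fun n => ?_
  have hn : ‖((n : ℂ) + 1) ^ 2‖ = ((n : ℝ) + 1) ^ 2 := by
    rw [norm_pow, ← Nat.cast_add_one, Complex.norm_natCast, Nat.cast_add_one]
  rw [norm_div, hn, norm_pow, pow_succ, one_div_mul_eq_div]
  gcongr
  exact mul_le_of_le_one_left (norm_nonneg z) (pow_le_one₀ (norm_nonneg z) hz)

/-- The kernel's real part has the sign of `Re z - t|z|²`. -/
theorem dilog_re_nonpos {z : ℂ} (hz : ‖z‖ ≤ 1) (hre : z.re ≤ 0) : (dilog z).re ≤ 0 := by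
  have h := re_mul_dilog_eq_integral hz 1
  rw [one_mul] at h
  rw [h]
  refine setIntegral_nonpos measurableSet_Ioo fun t ht => ?_
  have hl : 0 ≤ -Real.log t := neg_nonneg.2 (Real.log_nonpos ht.1.le ht.2.le)
  refine mul_nonpos_of_nonpos_of_nonneg ?_ hl
  rw [one_mul, Complex.div_re, ← add_div]
  refine div_nonpos_of_nonpos_of_nonneg ?_ (Complex.normSq_nonneg _)
  have : z.re * (1 - z * t).re + z.im * (1 - z * t).im = z.re - t * (z.re ^ 2 + z.im ^ 2) := by
    simp
    ring
  rw [this]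
  have := ht.1
  nlinarith [mul_nonneg this.le (add_nonneg (sq_nonneg z.re) (sq_nonneg z.im))]

/-- Pointwise lower bound for the kernel in the direction bisecting `x` and the positive axis. -/
theorem re_kernel_lower_bound {x : ℂ} (hx : ‖x‖ ≤ 1) {t : ℝ} (ht : t ∈ Ioo (0 : ℝ) 1) :
    ‖x‖ * (‖x‖ + x.re) * ((1 - t) * (25 / 27 - 125 / 108 * t)) ≤
      ((starRingEnd ℂ x + ‖x‖) * (x / (1 - x * t))).re := by
  obtain ⟨h0, h1⟩ := ht
  have hr0 := norm_nonneg x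
  set r := ‖x‖ with hr
  have hsq : x.re ^ 2 + x.im ^ 2 = r ^ 2 := by rw [hr, Complex.sq_norm, Complex.normSq_apply]; ring
  have ha : 0 ≤ r + x.re := by linarith [(abs_le.1 (Complex.abs_re_le_norm x)).1]
  have hpos : 0 < ‖1 - x * t‖ :=
    (sub_pos.2 h1).trans_le (one_sub_le_norm_one_sub_mul hx h0.le)
  have hD : Complex.normSq (1 - x * t) = 1 - 2 * t * x.re + t ^ 2 * r ^ 2 := by
    rw [← hsq, Complex.normSq_apply]
    simp
    ring
  have hDpos : 0 < Complex.normSq (1 - x * t) := by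
    rw [Complex.normSq_eq_norm_sq]
    positivity
  have hnum : ((starRingEnd ℂ x + r) * (x / (1 - x * t))).re =
      r * (r + x.re) * ((1 - r * t) / Complex.normSq (1 - x * t)) := by
    rw [← mul_div_assoc, Complex.div_re, ← add_div, ← mul_div_assoc]
    congr 1
    simp
    linear_combination (1 - x.re * t - r * t) * hsq
  rw [hnum]
  refine mul_le_mul_of_nonneg_left ?_ (mul_nonneg hr0 ha)
  rw [le_div_iff₀ hDpos]
  have hrt : r * t ≤ t := mul_le_of_le_one_left h0.le hx
  rcases le_total (25 / 27 - 125 / 108 * t) 0 with hl | hl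
  · have := mul_nonpos_of_nonneg_of_nonpos (sub_nonneg.2 h1.le) hl
    have := mul_nonpos_of_nonpos_of_nonneg this hDpos.le
    linarith
  · have hD' : Complex.normSq (1 - x * t) ≤ (1 + t) ^ 2 := by
      have h2 : (1 + r * t) ^ 2 ≤ (1 + t) ^ 2 := by gcongr
      rw [hD]
      linarith [mul_nonneg h0.le ha]
    -- The linear factor is the tangent to `(1 + t)⁻²` at `t = 1/5`; the gap is `(5t - 1)²(5t +
    -- 8)/108`.
    have htan : (25 / 27 - 125 / 108 * t) * (1 + t) ^ 2 ≤ 1 := by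
      linarith [mul_nonneg (sq_nonneg (5 * t - 1)) (by linarith : 0 ≤ 5 * t + 8)]
    calc (1 - t) * (25 / 27 - 125 / 108 * t) * Complex.normSq (1 - x * t)
        ≤ (1 - t) * (25 / 27 - 125 / 108 * t) * (1 + t) ^ 2 :=
          mul_le_mul_of_nonneg_left hD' (mul_nonneg (sub_nonneg.2 h1.le) hl)
      _ = (1 - t) * ((25 / 27 - 125 / 108 * t) * (1 + t) ^ 2) := by ring
      _ ≤ (1 - t) * 1 := mul_le_mul_of_nonneg_left htan (sub_nonneg.2 h1.le)
      _ ≤ 1 - r * t := by linarith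

/-- With a polynomial weight, only the rational moments `1/(n+1)²` of `-log t` enter. -/
theorem integral_tangent_weight :
    IntegrableOn (fun t : ℝ => (1 - t) * (25 / 27 - 125 / 108 * t) * -Real.log t) (Ioo 0 1) ∧
      8 / 15 ≤ ∫ t in Ioo (0 : ℝ) 1, (1 - t) * (25 / 27 - 125 / 108 * t) * -Real.log t := by
  have e : (fun t : ℝ => (1 - t) * (25 / 27 - 125 / 108 * t) * -Real.log t) = fun t =>
      25 / 27 * (t ^ 0 * -Real.log t) - 225 / 108 * (t ^ 1 * -Real.log t)
        + 125 / 108 * (t ^ 2 * -Real.log t) := by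
    funext t
    ring
  have i0 := (integrableOn_pow_mul_neg_log 0).const_mul (25 / 27)
  have i1 := (integrableOn_pow_mul_neg_log 1).const_mul (225 / 108)
  have i2 := (integrableOn_pow_mul_neg_log 2).const_mul (125 / 108)
  rw [e]
  refine ⟨(i0.sub i1).add i2, ?_⟩
  rw [integral_add (by exact i0.sub i1) i2, integral_sub i0 i1, integral_const_mul, integral_const_mul,
    integral_const_mul, integral_pow_mul_neg_log, integral_pow_mul_neg_log,
    integral_pow_mul_neg_log]
  norm_num

/-- Testing against `x̄ + |x|` linearizes the left side from below: `Re(x̄ w) ≤ |x||w|` for `w =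
Li₂(x)`. The kernel bound is then integrated. -/
theorem dilog_lower_bound {x : ℂ} (hx : ‖x‖ ≤ 1) :
    8 / 15 * (‖x‖ + x.re) ≤ ‖dilog x‖ + (dilog x).re := by
  rcases eq_or_ne x 0 with rfl | h0
  · simpa [neg_le_iff_add_nonneg'] using (abs_le.1 (Complex.abs_re_le_norm (dilog 0))).1
  have hr : 0 < ‖x‖ := norm_pos_iff.2 h0
  have ha : 0 ≤ ‖x‖ + x.re := by linarith [(abs_le.1 (Complex.abs_re_le_norm x)).1]
  obtain ⟨hi, hI⟩ := integral_tangent_weight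
  have h1 : ‖x‖ * (‖x‖ + x.re) * (8 / 15) ≤ ((starRingEnd ℂ x + ‖x‖) * dilog x).re := by
    refine (mul_le_mul_of_nonneg_left hI (mul_nonneg hr.le ha)).trans ?_
    rw [re_mul_dilog_eq_integral hx, ← integral_const_mul]
    refine setIntegral_mono_on (hi.const_mul _) (integrableOn_re_dilog_kernel hx _)
      measurableSet_Ioo fun t ht => ?_
    rw [← mul_assoc]
    exact mul_le_mul_of_nonneg_right (re_kernel_lower_bound hx ht)
      (neg_nonneg.2 (Real.log_nonpos ht.1.le ht.2.le))
  have h2 : ((starRingEnd ℂ x + ‖x‖) * dilog x).re ≤ ‖x‖ * (‖dilog x‖ + (dilog x).re) := by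
    have h := Complex.re_le_norm (starRingEnd ℂ x * dilog x)
    rw [norm_mul, Complex.norm_conj] at h
    rw [add_mul, Complex.add_re, Complex.re_ofReal_mul]
    linarith
  refine le_of_mul_le_mul_left ?_ hr
  linarith

/-! ### Bounds for the squares of `f_k` -/

theorem dilogF_nonneg (k : ℕ) (x : ℂ) : 0 ≤ dilogF k x := by
  rw [dilogF, Complex.sqrt, Complex.cpow_inv_two_re]
  positivity

theorem dilogF_sq (k : ℕ) (x : ℂ) :
    dilogF k x ^ 2 = (‖dilog (x ^ k)‖ + (dilog (x ^ k)).re) / (2 * (k : ℝ) ^ 2) := by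
  have h : 0 ≤ ‖dilog (x ^ k)‖ + (dilog (x ^ k)).re := by
    linarith [(abs_le.1 (Complex.abs_re_le_norm (dilog (x ^ k)))).1]
  rw [dilogF, Complex.sqrt, Complex.cpow_inv_two_re, mul_pow, Real.sq_sqrt (by positivity),
    div_pow, one_pow, div_mul_div_comm, one_mul, mul_comm]

theorem dilogF_one_sq_lower {x : ℂ} (hx : ‖x‖ ≤ 1) :
    4 / 15 * (‖x‖ + x.re) ≤ dilogF 1 x ^ 2 := by
  have h := dilog_lower_bound hx
  rw [dilogF_sq, pow_one]
  norm_num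
  linarith

theorem dilogF_two_sq_lower {x : ℂ} (hx : ‖x‖ ≤ 1) :
    2 / 15 * x.re ^ 2 ≤ dilogF 2 x ^ 2 := by
  have h := dilog_lower_bound (x := x ^ 2) (by rw [norm_pow]; exact pow_le_one₀ (norm_nonneg x) hx)
  -- `|x|² + Re x²` loses its imaginary part.
  have hre : ‖x ^ 2‖ + (x ^ 2).re = 2 * x.re ^ 2 := by
    rw [norm_pow, Complex.sq_norm, Complex.normSq_apply, pow_two, Complex.mul_re]
    ring
  rw [hre] at h
  rw [dilogF_sq]
  norm_num
  linarith

theorem pi_sq_div_six_lt : Real.pi ^ 2 / 6 < 1.645 := by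
  nlinarith [Real.pi_lt_d4, Real.pi_pos]

theorem norm_dilog_pow_le {x : ℂ} (hx : ‖x‖ ≤ 1) {k : ℕ} (hk : 2 ≤ k) :
    ‖dilog (x ^ k)‖ ≤ 1.645 * ‖x‖ ^ 2 := by
  have h := norm_dilog_le (z := x ^ k) (by rw [norm_pow]; exact pow_le_one₀ (norm_nonneg x) hx)
  rw [norm_pow] at h
  have h2 : ‖x‖ ^ k ≤ ‖x‖ ^ 2 := pow_le_pow_of_le_one (norm_nonneg x) hx hk
  have h3 := pi_sq_div_six_lt
  exact h.trans (mul_le_mul h3.le h2 (by positivity) (by norm_num))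

theorem dilogF_sq_le {x : ℂ} (hx : ‖x‖ ≤ 1) {k : ℕ} (hk : 2 ≤ k) :
    dilogF k x ^ 2 ≤ 1.645 * ‖x‖ ^ 2 / (k : ℝ) ^ 2 := by
  have hk0 : (0 : ℝ) < k := by exact_mod_cast (by lia : 0 < k)
  rw [dilogF_sq, mul_comm 2, ← div_div, div_right_comm]
  gcongr
  linarith [norm_dilog_pow_le hx hk, Complex.re_le_norm (dilog (x ^ k))]

theorem dilogF_sq_le_of_re_nonpos {x : ℂ} (hx : ‖x‖ ≤ 1) {k : ℕ} (hk : 2 ≤ k)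
    (hre : (x ^ k).re ≤ 0) : dilogF k x ^ 2 ≤ 1.645 * ‖x‖ ^ 2 / (2 * (k : ℝ) ^ 2) := by
  have hk0 : (0 : ℝ) < k := by exact_mod_cast (by lia : 0 < k)
  have hx' : ‖x ^ k‖ ≤ 1 := by rw [norm_pow]; exact pow_le_one₀ (norm_nonneg x) hx
  rw [dilogF_sq]
  gcongr
  linarith [norm_dilog_pow_le hx hk, dilog_re_nonpos hx' hre]

theorem dilogF_le_max_of_sq_le {x : ℂ} (hx : ‖x‖ ≤ 1) {k : ℕ}
    (hk : dilogF k x ^ 2 ≤ 4 / 15 * (‖x‖ + x.re) ∨ dilogF k x ^ 2 ≤ 2 / 15 * x.re ^ 2) :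
    dilogF k x ≤ max (dilogF 1 x) (dilogF 2 x) := by
  rcases hk with h | h
  · exact le_max_of_le_left
      (abs_le_of_sq_le_sq' (h.trans (dilogF_one_sq_lower hx)) (dilogF_nonneg 1 x)).2
  · exact le_max_of_le_right
      (abs_le_of_sq_le_sq' (h.trans (dilogF_two_sq_lower hx)) (dilogF_nonneg 2 x)).2

/-! ### Comparison of the bounds -/

theorem weak_bound_le {r a : ℝ} (h0 : 0 ≤ r) (h1 : r ≤ 1) :
    1.645 * r ^ 2 / 25 ≤ 4 / 15 * (r + a) ∨ 1.645 * r ^ 2 / 25 ≤ 2 / 15 * a ^ 2 := by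
  have hr : r ^ 2 ≤ r := by nlinarith
  rcases le_total (-0.72 * r) a with h | h
  · left
    linarith
  · right
    have : (0.72 * r) ^ 2 ≤ (-a) ^ 2 := by gcongr; linarith
    linarith [sq_nonneg r]

/-- `hre` says `cos 4θ ≥ 0`, which excludes `0.36 ≤ cos² θ ≤ 0.78`. So once `a ≤ -0.6 r`, `a²` must
exceed `0.78 r²`, enough for the second alternative. -/
theorem strong_bound_le {r a b : ℝ} (h0 : 0 ≤ r) (h1 : r ≤ 1) (hab : a ^ 2 + b ^ 2 = r ^ 2)
    (hre : 0 ≤ a ^ 4 - 6 * a ^ 2 * b ^ 2 + b ^ 4) :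
    1.645 * r ^ 2 / 16 ≤ 4 / 15 * (r + a) ∨ 1.645 * r ^ 2 / 16 ≤ 2 / 15 * a ^ 2 := by
  have hr : r ^ 2 ≤ r := by nlinarith
  rcases le_total (-0.6 * r) a with h | h
  · left
    linarith
  · right
    have h6 : (0.6 * r) ^ 2 ≤ (-a) ^ 2 := by gcongr; linarith
    by_contra! hlt
    have hA : a ^ 2 < 0.78 * r ^ 2 := by nlinarith [sq_nonneg r]
    have hb : b ^ 2 = r ^ 2 - a ^ 2 := by linarith
    have hb4 : b ^ 4 = (r ^ 2 - a ^ 2) ^ 2 := by rw [← hb]; ring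
    rw [hb4, hb] at hre
    nlinarith [mul_nonneg (sub_nonneg.2 h6) (sub_nonneg.2 hA.le), sq_nonneg r, sq_nonneg a]

theorem dilogF_le_max_one_two {x : ℂ} (hx : ‖x‖ ≤ 1) {k : ℕ} (hk : 4 ≤ k) :
    dilogF k x ≤ max (dilogF 1 x) (dilogF 2 x) := by
  have hr := norm_nonneg x
  have of_weak (h : dilogF k x ^ 2 ≤ 1.645 * ‖x‖ ^ 2 / 25) :
      dilogF k x ≤ max (dilogF 1 x) (dilogF 2 x) :=
    dilogF_le_max_of_sq_le hx ((weak_bound_le hr hx).imp h.trans h.trans)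
  rcases hk.eq_or_lt with rfl | hk
  · rcases le_total (x ^ 4).re 0 with hre | hre
    -- A nonpositive real part halves the bound: `1/32` instead of `1/16`, below `1/25`.
    · refine of_weak ((dilogF_sq_le_of_re_nonpos hx (by norm_num) hre).trans ?_)
      norm_num
      linarith [sq_nonneg ‖x‖]
    · have h := dilogF_sq_le hx (k := 4) (by norm_num)
      norm_num at h
      have hab : x.re ^ 2 + x.im ^ 2 = ‖x‖ ^ 2 := by
        rw [Complex.sq_norm, Complex.normSq_apply]
        ring
      have hre' : (x ^ 4).re = x.re ^ 4 - 6 * x.re ^ 2 * x.im ^ 2 + x.im ^ 4 := by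
        simp [pow_succ]
        ring
      have hs := strong_bound_le hr hx hab (hre' ▸ hre)
      norm_num at hs
      exact dilogF_le_max_of_sq_le hx (hs.imp h.trans h.trans)
  · refine of_weak ((dilogF_sq_le hx (by lia)).trans ?_)
    have : (5 : ℝ) ≤ k := by exact_mod_cast hk
    gcongr
    nlinarith

theorem mainTheorem4 :
    (∀ x ∈ unitDisk, ∀ k : ℕ, 4 ≤ k →
      dilogF k x ≤ max (dilogF 1 x) (max (dilogF 2 x) (dilogF 3 x))) ∧
    (∀ x ∈ regionOne, ∀ k : ℕ, 2 ≤ k → dilogF k x ≤ dilogF 1 x) ∧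
    (∀ x ∈ regionTwo, ∀ k : ℕ, 3 ≤ k ∨ k = 1 → dilogF k x ≤ dilogF 2 x) ∧
    (∀ x ∈ regionThree, ∀ k : ℕ, 4 ≤ k ∨ k = 1 ∨ k = 2 → dilogF k x ≤ dilogF 3 x) := by
  have main : ∀ x ∈ unitDisk, ∀ k : ℕ, 4 ≤ k →
      dilogF k x ≤ max (dilogF 1 x) (dilogF 2 x) := fun x hx k hk =>
    dilogF_le_max_one_two (mem_closedBall_zero_iff.1 hx) hk
  refine ⟨fun x hx k hk => (main x hx k hk).trans ?_, ?_, ?_, ?_⟩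
  · exact max_le_max_left _ (le_max_left _ _)
  · rintro x ⟨hx, h2, h3⟩ k hk
    obtain rfl | rfl | hk : k = 2 ∨ k = 3 ∨ 4 ≤ k := by lia
    · exact h2
    · exact h3
    · exact (main x hx k hk).trans (max_le le_rfl h2)
  · rintro x ⟨hx, h1, h3⟩ k hk
    obtain rfl | rfl | hk : k = 1 ∨ k = 3 ∨ 4 ≤ k := by lia
    · exact h1
    · exact h3
    · exact (main x hx k hk).trans (max_le h1 le_rfl)
  · rintro x ⟨hx, h1, h2⟩ k hk
    obtain rfl | rfl | hk : k = 1 ∨ k = 2 ∨ 4 ≤ k := by lia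
    · exact h1
    · exact h2
    · exact (main x hx k hk).trans (max_le h1 h2)
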